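/- For a stationary set $E\subseteq\omega_1$ let $\mathsf{stat}_E$ be the family of all stationary subsets $S$ of $\omega_1$ with $S\subseteq E$. A poset $\mathbb P$ (preordered set) is $\mathsf{stat}_E$-pc if for every $S\in\mathsf{stat}_E$ and every sequence $\langle p_\alpha : \alpha\in S\rangle$ in $\mathbb P$ there is $T\subseteq S$ with $T\in\mathsf{stat}_E$ such that $\langle p_\alpha:\alpha\in T\rangle$ is centered, i.e. for every finite $F\subseteq T$ the conditions $p_\alpha$ $(\alpha\in F)$ have a common extension in $\mathbb P$. For $n<\omega$, $\mathbb P$ is $\mathsf{stat}_E$-$n$-Knaster if the same holds with "centered" replaced by "$n$-linked", i.e. only finite sets $F\subseteq T$ with $|F|\le n$ are considered. Let $E\subseteq\omega_1$ be stationary. Let $\langle \mathbb P_\xi,\dot{\mathbb Q}_\eta : \xi\le\gamma,\ \eta<\gamma\rangle$ be a finite support iteration of arbitrary ordinal length $\gamma$: each $\dot{\mathbb Q}_\eta$ is a $\mathbb P_\eta$-name for a poset with a largest element; $\mathbb P_\xi$ consists of the functions $p$ with domain $\xi$ such that $p(\eta)\ne\dot 1_{\dot{\mathbb Q}_\eta}$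 for only finitely many $\eta$ and, for every $\eta<\xi$, $p{\upharpoonright}\eta\in\mathbb P_\eta$, $p(\eta)$ belongs to the domain of the name $\dot{\mathbb Q}_\eta$ and $p{\upharpoonright}\eta\Vdash p(\eta)\in\dot{\mathbb Q}_\eta$; and $p\le q$ in $\mathbb P_\xi$ iff $p{\upharpoonright}\eta\Vdash p(\eta)\le q(\eta)$ for all $\eta<\xi$. 1. If $\Vdash_{\mathbb P_\eta}$ "$\dot{\mathbb Q}_\eta$ is $\mathsf{stat}_{E}$-pc" for every $\eta<\gamma$, then $\mathbb P_\gamma$ is $\mathsf{stat}_E$-pc. 2. For every $n<\omega$: if $\Vdash_{\mathbb P_\eta}$ "$\dot{\mathbb Q}_\eta$ is $\mathsf{stat}_{E}$-$n$-Knaster" for every $\eta<\gamma$, then $\mathbb P_\gamma$ is $\mathsf{stat}_E$-$n$-Knaster. -/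

import Mathlib

universe u

namespace StatIter

/-! ### The cardinal `ω₁`, stationary families, and chain conditions in the ground model -/

/-- The ordinal `ω₁`, as a well-ordered type in the universe `u`. -/
abbrev Omega1 : Type u := (Ordinal.omega.{u} 1).ToType

/-- `stat_E`: the stationary subsets of `ω₁` that are contained in `E`. -/
def stat (E : Set Omega1.{u}) : Set (Set Omega1.{u}) := {S | S ⊆ E ∧ IsStationary S}

/-- The part with index set `T` of the sequence `p` is centered:
any finitely many of its terms have a common extension. -/
def IsCenteredOn {P : Type u} [Preorder P] {S : Set Omega1.{u}} (p : S → P)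
    (T : Set Omega1.{u}) : Prop :=
  ∀ F : Finset S, (∀ α ∈ F, (α : Omega1.{u}) ∈ T) → ∃ r : P, ∀ α ∈ F, r ≤ p α

/-- The part with index set `T` of the sequence `p` is `n`-linked:
any (at most) `n` of its terms have a common extension. -/
def IsLinkedOn {P : Type u} [Preorder P] (n : ℕ) {S : Set Omega1.{u}} (p : S → P)
    (T : Set Omega1.{u}) : Prop :=
  ∀ F : Finset S, F.card ≤ n → (∀ α ∈ F, (α : Omega1.{u}) ∈ T) → ∃ r : P, ∀ α ∈ F, r ≤ p α

/-- `P` is an `𝒜`-pc poset: every sequence with index set in `𝒜` has a centered subsequence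
with index set in `𝒜`. -/
def IsPC (𝒜 : Set (Set Omega1.{u})) (P : Type u) [Preorder P] : Prop :=
  ∀ S ∈ 𝒜, ∀ p : S → P, ∃ T ∈ 𝒜, T ⊆ S ∧ IsCenteredOn p T

/-- `P` is an `𝒜`-`n`-Knaster poset: every sequence with index set in `𝒜` has an `n`-linked
subsequence with index set in `𝒜`. -/
def IsKnaster (𝒜 : Set (Set Omega1.{u})) (n : ℕ) (P : Type u) [Preorder P] : Prop :=
  ∀ S ∈ 𝒜, ∀ p : S → P, ∃ T ∈ 𝒜, T ⊆ S ∧ IsLinkedOn n p T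

/-! ### Names and the forcing relation

As usual in forcing, a poset is a preordered set; `q ≤ p` means that `q` extends `p`. -/

/-- `P`-names. The name `mk ι c x` is the set of pairs `{(x i, p) | i : ι, p ∈ c i}`; its domain is
`{x i | i : ι}`. -/
inductive PName (P : Type u) : Type (u + 1)
  | mk (ι : Type u) (c : ι → Set P) (x : ι → PName P) : PName P

/-- A statement of the forcing language of `P`, given by the conditions that force it. -/
def Sentence (P : Type u) : Type u := P → Prop

section
variable {P : Type u}

/-- `p ⊩ φ`: the condition `p` forces `φ`. -/
def Forces (p : P) (φ : Sentence P) : Prop := φ p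

/-- The forcing relation. -/
infix:45 " ⊩ " => Forces

variable [Preorder P]

/-- `p` forces `x = y` iff, for each `(x i, s) ∈ x`, every extension of both `p` and `s` has an
extension `r` such that `r ≤ s'` and `r` forces `x i = y j` for some `(y j, s') ∈ y`;
and symmetrically. -/
def PName.eq : PName P → PName P → Sentence P
  | .mk ι c x, .mk κ d y => fun p =>
    (∀ i : ι, ∀ s ∈ c i, ∀ q ≤ p, q ≤ s →
      ∃ r ≤ q, ∃ j : κ, (∃ s' ∈ d j, r ≤ s') ∧ PName.eq (x i) (y j) r) ∧
    (∀ j : κ, ∀ s ∈ d j, ∀ q ≤ p, q ≤ s →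
      ∃ r ≤ q, ∃ i : ι, (∃ s' ∈ c i, r ≤ s') ∧ PName.eq (x i) (y j) r)

/-- `p` forces `x ∈ y` iff the set of `r` such that `r ≤ s` and `r` forces `x = y j`
for some `(y j, s) ∈ y` is dense below `p`. -/
def PName.mem (x : PName P) : PName P → Sentence P
  | .mk κ d y => fun p =>
    ∀ q ≤ p, ∃ r ≤ q, ∃ j : κ, (∃ s ∈ d j, r ≤ s) ∧ r ⊩ PName.eq x (y j)

/-- Conjunction. -/
def Sentence.and (φ ψ : Sentence P) : Sentence P := fun p => (p ⊩ φ) ∧ (p ⊩ ψ)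

/-- Implication. -/
def Sentence.imp (φ ψ : Sentence P) : Sentence P := fun p => ∀ q ≤ p, (q ⊩ φ) → (q ⊩ ψ)

/-- Universal quantification, over all names or over a set of the ground model
(that is, over the check names of its elements). -/
def all {ι : Sort*} (φ : ι → Sentence P) : Sentence P := fun p => ∀ i, p ⊩ φ i

/-- Existential quantification, over all names or over a set of the ground model
(that is, over the check names of its elements). -/
def ex {ι : Sort*} (φ : ι → Sentence P) : Sentence P := fun p => ∀ q ≤ p, ∃ r ≤ q, ∃ i, r ⊩ φ i

/-- The name of the unordered pair `{x, y}`. -/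
def PName.upair (x y : PName P) : PName P :=
  .mk (ULift.{u} Bool) (fun _ => Set.univ) (fun b => bif b.down then x else y)

/-- The name of the Kuratowski ordered pair `(x, y)`. -/
def PName.opair (x y : PName P) : PName P := .upair (.upair x x) (.upair x y)

/-- The check name of a countable ordinal `α`, namely of the set of all smaller ordinals. -/
noncomputable def check (P : Type u) (α : Omega1.{u}) : PName P :=
  .mk (Set.Iio α) (fun _ => Set.univ) (fun β => check P β.1)
termination_by α
decreasing_by exact β.2

/-- The check name of a set of countable ordinals. -/
noncomputable def checkSet (P : Type u) (E : Set Omega1.{u}) : PName P :=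
  .mk E (fun _ => Set.univ) (fun β => check P β.1)

/-- The statement `x ⊆ y`. -/
def subset (x y : PName P) : Sentence P := all fun z : PName P => (z.mem x).imp (z.mem y)

/-- The statement that `C` is a closed unbounded subset of `ω₁`. -/
noncomputable def isClub (C : PName P) : Sentence P :=
  (subset C (checkSet P Set.univ)).and <|
  Sentence.and
    (all fun α : Omega1.{u} => ex fun β : {β : Omega1.{u} // α < β} => (check P β.1).mem C)
    (all fun δ : {δ : Omega1.{u} // Order.IsSuccLimit δ} =>
      Sentence.imp
        (all fun α : {α : Omega1.{u} // α < δ.1} =>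
          ex fun β : {β : Omega1.{u} // α.1 < β ∧ β < δ.1} => (check P β.1).mem C)
        ((check P δ.1).mem C))

/-- The statement that `S` is a stationary subset of `ω₁` and is contained in `E`,
where `E` is a set in the ground model. -/
noncomputable def isStat (E : Set Omega1.{u}) (S : PName P) : Sentence P :=
  (subset S (checkSet P E)).and <|
  all fun C : PName P => (isClub C).imp <|
    ex fun α : Omega1.{u} => ((check P α).mem C).and ((check P α).mem S)

/-- The statement that `f` is a function from `S` to `Q`, where `S ⊆ ω₁`. -/
noncomputable def isFun (f S Q : PName P) : Sentence P :=
  Sentence.and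
    (all fun z : PName P => (z.mem f).imp <|
      ex fun α : Omega1.{u} => ex fun x : PName P =>
        ((check P α).mem S).and ((x.mem Q).and (z.eq (.opair (check P α) x)))) <|
  Sentence.and
    (all fun α : Omega1.{u} => ((check P α).mem S).imp <|
      ex fun x : PName P => (PName.opair (check P α) x).mem f)
    (all fun α : Omega1.{u} => all fun x : PName P => all fun y : PName P =>
      (((PName.opair (check P α) x).mem f).and ((PName.opair (check P α) y).mem f)).imp (x.eq y))

/-- The statement that, in the set `Q` ordered by `le`, the terms `f(α)`, `α ∈ F`,
have a common extension, where `F` is a finite set in the ground model. -/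
noncomputable def hasLowerBound (Q le f : PName P) (F : Finset Omega1.{u}) : Sentence P :=
  ex fun q : PName P => (q.mem Q).and <|
    all fun α : {α : Omega1.{u} // α ∈ F} => all fun x : PName P =>
      ((PName.opair (check P α.1) x).mem f).imp ((PName.opair q x).mem le)

/-- The statement that the part with index set `T` of the sequence `f` is centered in `(Q, le)`.
The finite subsets of `ω₁` are the same in the ground model and in its generic extensions. -/
noncomputable def isCenteredOn (Q le f T : PName P) : Sentence P :=
  all fun F : Finset Omega1.{u} =>
    (all fun α : {α : Omega1.{u} // α ∈ F} => (check P α.1).mem T).imp (hasLowerBound Q le f F)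

/-- The statement that the part with index set `T` of the sequence `f` is `n`-linked in
`(Q, le)`. -/
noncomputable def isLinkedOn (n : ℕ) (Q le f T : PName P) : Sentence P :=
  all fun F : {F : Finset Omega1.{u} // F.card ≤ n} =>
    (all fun α : {α : Omega1.{u} // α ∈ F.1} => (check P α.1).mem T).imp
      (hasLowerBound Q le f F.1)

/-- The statement that `(Q, le)` is a `stat_E`-pc poset. -/
noncomputable def isStatPC (E : Set Omega1.{u}) (Q le : PName P) : Sentence P :=
  all fun S : PName P => all fun f : PName P => ((isStat E S).and (isFun f S Q)).imp <|
    ex fun T : PName P => (isStat E T).and ((subset T S).and (isCenteredOn Q le f T))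

/-- The statement that `(Q, le)` is a `stat_E`-`n`-Knaster poset. -/
noncomputable def isStatKnaster (E : Set Omega1.{u}) (n : ℕ) (Q le : PName P) : Sentence P :=
  all fun S : PName P => all fun f : PName P => ((isStat E S).and (isFun f S Q)).imp <|
    ex fun T : PName P => (isStat E T).and ((subset T S).and (isLinkedOn n Q le f T))

/-- The statement that `le` is a preorder of the set `Q` with largest element `one`. -/
def isPoset (Q le one : PName P) : Sentence P :=
  (one.mem Q).and <|
  (all fun x : PName P => (x.mem Q).imp ((PName.opair x one).mem le)).and <|
  (all fun x : PName P => (x.mem Q).imp ((PName.opair x x).mem le)).and <|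
  all fun x : PName P => all fun y : PName P => all fun z : PName P =>
    ((x.mem Q).and ((y.mem Q).and ((z.mem Q).and
      (((PName.opair x y).mem le).and ((PName.opair y z).mem le))))).imp
        ((PName.opair x z).mem le)

end

/-! ### Finite support iterations -/

/-- A `P`-name for a poset with a largest element: a name for its underlying set, whose domain is
indexed by `D`, a name for its order, and an element of the domain which names the largest
element. -/
structure PosetName (P : Type u) [Preorder P] (D : Type u) where
  /-- The conditions attached to the elements of the domain. -/
  cond : D → Set P
  /-- The names that form the domain. -/
  val : D → PName P
  /-- The name of the order, a set of ordered pairs. -/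
  le : PName P
  /-- The largest element. -/
  one : D
  /-- Every condition forces that this is a poset with a largest element. -/
  forces_isPoset : ∀ p : P, p ⊩ isPoset (.mk D cond val) le (val one)

/-- The name of the underlying set. -/
def PosetName.set {P : Type u} [Preorder P] {D : Type u} (Q : PosetName P D) : PName P :=
  .mk D Q.cond Q.val

/-- The restriction to `ξ` of a function with domain `a`, for `ξ < a`. -/
def restrict {I : Type u} [LinearOrder I] {D : I → Type u} {a : WithTop I}
    (f : ∀ ξ : {ξ : I // (ξ : WithTop I) < a}, D ξ.1) (ξ : {ξ : I // (ξ : WithTop I) < a}) :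
    ∀ η : {η : I // (η : WithTop I) < (ξ.1 : WithTop I)}, D η.1 :=
  fun η => f ⟨η.1, η.2.trans ξ.2⟩

/-- A finite support iteration `⟨P_a, Q_ξ : a ≤ γ, ξ < γ⟩`, where `γ` is the order type of the
well-order `I`. The stages `a ≤ γ` are the elements of `WithTop I`, where `⊤` stands for `γ`. -/
structure FSIteration (I : Type u) [LinearOrder I] [WellFoundedLT I] where
  /-- The domain of the name `Q_ξ`. -/
  dom : I → Type u
  /-- The set of conditions of `P_a`: certain functions with domain `a`. -/
  carrier : ∀ a : WithTop I, Set (∀ ξ : {ξ : I // (ξ : WithTop I) < a}, dom ξ.1)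
  /-- The order of `P_a`. -/
  order : ∀ a : WithTop I, Preorder (carrier a)
  /-- The `P_ξ`-name `Q_ξ` for a poset. -/
  Q : ∀ ξ : I, @PosetName (carrier ξ) (order ξ) (dom ξ)
  /-- A function `f` is a condition of `P_a` iff it has finite support and, for all `ξ < a`,
  the restriction of `f` to `ξ` is a condition of `P_ξ` which forces `f(ξ) ∈ Q_ξ`. -/
  mem_carrier_iff : ∀ (a : WithTop I) (f : ∀ ξ : {ξ : I // (ξ : WithTop I) < a}, dom ξ.1),
    f ∈ carrier a ↔
      {ξ | f ξ ≠ (Q ξ.1).one}.Finite ∧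
      ∀ ξ, ∃ h : restrict f ξ ∈ carrier ξ.1,
        letI := order ξ.1
        (⟨restrict f ξ, h⟩ : carrier ξ.1) ⊩ ((Q ξ.1).val (f ξ)).mem (Q ξ.1).set
  /-- `p ≤ q` in `P_a` iff, for all `ξ < a`, the restriction of `p` to `ξ` forces
  `p(ξ) ≤ q(ξ)` in `Q_ξ`. -/
  le_iff : ∀ (a : WithTop I) (p q : carrier a),
    (letI := order a; p ≤ q) ↔
      ∀ ξ, ∃ h : restrict p.1 ξ ∈ carrier ξ.1,
        letI := order ξ.1
        (⟨restrict p.1 ξ, h⟩ : carrier ξ.1) ⊩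
          (PName.opair ((Q ξ.1).val (p.1 ξ)) ((Q ξ.1).val (q.1 ξ))).mem (Q ξ.1).le

namespace FSIteration
variable {I : Type u} [LinearOrder I] [WellFoundedLT I]

/-- The poset `P_a`. -/
abbrev P (𝕀 : FSIteration I) (a : WithTop I) : Type u := 𝕀.carrier a

instance (𝕀 : FSIteration I) (a : WithTop I) : Preorder (𝕀.P a) := 𝕀.order a

/-- The iteration is an iteration of `stat_E`-pc posets: each `P_ξ` forces that `Q_ξ` is
`stat_E`-pc. -/
def OfStatPC (𝕀 : FSIteration I) (E : Set Omega1.{u}) : Prop :=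
  ∀ ξ : I, ∀ p : 𝕀.P ξ, p ⊩ isStatPC E (𝕀.Q ξ).set (𝕀.Q ξ).le

/-- The iteration is an iteration of `stat_E`-`n`-Knaster posets: each `P_ξ` forces that `Q_ξ` is
`stat_E`-`n`-Knaster. -/
def OfStatKnaster (𝕀 : FSIteration I) (E : Set Omega1.{u}) (n : ℕ) : Prop :=
  ∀ ξ : I, ∀ p : 𝕀.P ξ, p ⊩ isStatKnaster E n (𝕀.Q ξ).set (𝕀.Q ξ).le

/-- The poset `P_γ` of the whole iteration. -/
abbrev limit (𝕀 : FSIteration I) : Type u := 𝕀.P ⊤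

end FSIteration

end StatIter

/-!
Both chain conditions are instances of one property, `IsStatLinked ok`, in which `ok` says how many
terms of a sequence have to have a common extension at once. For `n ≤ 1` the `n`-Knaster property is
trivial; otherwise pairs are allowed, and the property implies the countable chain condition
(`IsStatLinked.exists_countable_predense`).

One step of the iteration is `IsStatLinked.two_step`. Given conditions `r α` and names `d α` for
elements of `Q`, for `α ∈ S`, consider in the extension the set of those `α ∈ S` with `r α` in the
generic filter. By the countable chain condition, clubs of the extension contain clubs of the ground
model, so some condition forces this set to be stationary
(`IsStatLinked.exists_forces_isStat`): otherwise countably many clubs of the ground model would have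
an intersection disjoint from `S`. The chain condition of `Q` then yields a name `T` for a stationary
subset on which the `d α` are linked. The ordinals `α` that may belong to `T` form a stationary set
in the ground model, and for each of them some extension of `r α` decides that `α ∈ T`. The chain
condition of the ground model poset, applied to these extensions, gives the result.

For the whole iteration, Fodor's lemma gives a `Δ`-system lemma for stationary sets
(`exists_stationary_deltaSystem`), by which the supports of the conditions may be assumed to form a
`Δ`-system with a finite root. If the root is empty, finitely many of the conditions have a common
extension, whose value at each coordinate is that of the only condition that is nontrivial there. If
`η` is the largest element of the root, then the stage `η` has the property by induction, the two-step
lemma takes care of the coordinate `η`, and above `η` the supports are disjoint again.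
-/


namespace StatIter
open Set Cardinal

/-! ### Clubs and stationary sets in `ω₁` -/

instance : Nonempty Omega1.{u} := Ordinal.nonempty_toType_iff.2 (Ordinal.omega_pos 1).ne'

theorem cof_omega1 : Order.cof Omega1.{u} = ℵ₁ := by
  rw [Ordinal.cof_toType, Cardinal.cof_omega_one]

theorem cof_omega1_ne_aleph0 : Order.cof Omega1.{u} ≠ ℵ₀ := by
  rw [cof_omega1]; exact Cardinal.aleph0_lt_aleph_one.ne'

instance : NoMaxOrder Omega1.{u} := by
  have h : NoTopOrder Omega1.{u} := by
    rw [← Order.one_lt_cof_iff, cof_omega1]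
    exact Cardinal.one_lt_aleph0.trans Cardinal.aleph0_lt_aleph_one
  exact noTopOrder_iff_noMaxOrder _ |>.1 h

theorem countable_Iio_omega1 (α : Omega1.{u}) : (Iio α).Countable := by
  have h := Cardinal.mk_Iio_lt α (by simp)
  rw [Cardinal.mk_toType, Ordinal.card_omega, Cardinal.lt_aleph_one_iff] at h
  exact Cardinal.le_aleph0_iff_set_countable.1 h

theorem countable_Iic_omega1 (α : Omega1.{u}) : (Iic α).Countable := by
  rw [← Iio_insert]
  exact (countable_Iio_omega1 α).insert α

theorem exists_forall_lt_of_countable {A : Set Omega1.{u}} (hA : A.Countable) :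
    ∃ β, ∀ α ∈ A, α < β := by
  have h : ¬ IsCofinal A := fun h => by
    have := Order.cof_le h
    rw [cof_omega1] at this
    exact (this.trans (Cardinal.le_aleph0_iff_set_countable.2 hA)).not_gt
      Cardinal.aleph0_lt_aleph_one
  simpa [not_isCofinal_iff] using h

theorem exists_isLUB_of_bddAbove {A : Set Omega1.{u}} (hA : BddAbove A) : ∃ δ, IsLUB A δ := by
  obtain ⟨δ, hδ, hmin⟩ := WellFounded.has_min (wellFounded_lt (α := Omega1.{u})) _ hA
  exact ⟨δ, hδ, fun γ hγ => not_lt.1 (hmin γ hγ)⟩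

/-- The closure points of a function on `ω₁` are unbounded. -/
theorem exists_gt_forall_map_lt (g : Omega1.{u} → Omega1.{u}) (α : Omega1.{u}) :
    ∃ δ > α, ∀ x < δ, g x < δ := by
  have h : ∀ x, ∃ y, x < y ∧ ∀ z ≤ x, g z < y := fun x => by
    obtain ⟨y, hy⟩ :=
      exists_forall_lt_of_countable (((countable_Iic_omega1 x).image g).insert x)
    exact ⟨y, hy x (mem_insert ..), fun z hz => hy _ (mem_insert_of_mem _ ⟨z, hz, rfl⟩)⟩
  choose h h1 h2 using h
  have hb : BddAbove (range fun n => h^[n] α) := by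
    obtain ⟨β, hβ⟩ := exists_forall_lt_of_countable (countable_range fun n => h^[n] α)
    exact ⟨β, fun x hx => (hβ x hx).le⟩
  obtain ⟨δ, hδ⟩ := exists_isLUB_of_bddAbove hb
  refine ⟨δ, (h1 α).trans_le (hδ.1 ⟨1, rfl⟩), fun x hx => ?_⟩
  obtain ⟨_, ⟨n, rfl⟩, hn⟩ := (lt_isLUB_iff hδ).1 hx
  refine (h2 _ x hn.le).trans_le (hδ.1 ⟨n + 1, ?_⟩)
  simp only [Function.iterate_succ_apply']

theorem isClub_Ici (α : Omega1.{u}) : IsClub (Ici α) :=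
  ⟨(isUpperSet_Ici α).dirSupClosed, fun β => ⟨max α β, mem_Ici.2 (le_max_left ..), le_max_right ..⟩⟩

/-- The diagonal intersection of clubs is a club. -/
theorem isClub_diagonal {C : Omega1.{u} → Set Omega1.{u}} (hC : ∀ γ, IsClub (C γ)) :
    IsClub {δ | ∀ γ < δ, δ ∈ C γ} := by
  constructor
  · rw [dirSupClosed_iff_of_linearOrder]
    intro d hd _ δ hδ γ hγ
    obtain ⟨β, hβ, hγβ⟩ := (lt_isLUB_iff hδ).1 hγ
    refine (hC γ).isLUB_mem (t := d ∩ Ioi γ) (fun x hx => hd hx.1 γ hx.2) ⟨β, hβ, hγβ⟩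
      ⟨fun x hx => hδ.1 hx.1, fun y hy => hδ.2 fun x hx => ?_⟩
    rcases le_or_gt x γ with h | h
    · exact h.trans (hγβ.le.trans (hy ⟨hβ, hγβ⟩))
    · exact hy ⟨hx, h⟩
  · intro α
    have h : ∀ x, ∃ y, x < y ∧ ∀ γ ≤ x, y ∈ C γ := fun x => by
      have : Countable (Iic x) := (countable_Iic_omega1 x).to_subtype
      obtain ⟨z, hz⟩ := exists_gt x
      obtain ⟨y, hy, hzy⟩ := (IsClub.iInter_of_countable cof_omega1_ne_aleph0
        fun γ : Iic x => hC γ).isCofinal z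
      exact ⟨y, hz.trans_le hzy, fun γ hγ => mem_iInter.1 hy ⟨γ, hγ⟩⟩
    choose g h1 h2 using h
    obtain ⟨δ, hδ, hg⟩ := exists_gt_forall_map_lt g α
    refine ⟨δ, fun γ hγ => ?_, hδ.le⟩
    refine (hC γ).isLUB_mem (t := g '' Ico γ δ) (image_subset_iff.2 fun x hx => h2 x γ hx.1)
      ⟨_, γ, ⟨le_rfl, hγ⟩, rfl⟩ ⟨?_, fun y hy => not_lt.1 fun hyδ => ?_⟩
    · rintro _ ⟨x, hx, rfl⟩
      exact (hg x hx.2).le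
    · have := hy ⟨max γ y, ⟨le_max_left .., max_lt hγ hyδ⟩, rfl⟩
      exact ((le_max_right γ y).trans_lt (h1 _)).not_ge this

/-- Fodor's lemma for finite sets: a function that assigns to each `α` in a stationary set a finite
set of smaller ordinals is constant on a stationary set. -/
theorem exists_stationary_const_finset {S : Set Omega1.{u}} (hS : IsStationary S)
    (A : Omega1.{u} → Finset Omega1.{u}) (hA : ∀ α ∈ S, ∀ β ∈ A α, β < α) :
    ∃ B, IsStationary {α ∈ S | A α = B} := by
  obtain ⟨γ, hγ⟩ : ∃ γ, IsStationary {α ∈ S | ∀ β ∈ A α, β ≤ γ} := by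
    by_contra! h
    simp_rw [not_isStationary_iff] at h
    choose C hC hd using h
    obtain ⟨a⟩ := (inferInstance : Nonempty Omega1.{u})
    obtain ⟨b, hab⟩ := exists_gt a
    obtain ⟨δ, hδS, hδ, hbδ⟩ :=
      hS ((isClub_diagonal hC).inter cof_omega1_ne_aleph0 (isClub_Ici b))
    -- `insert a` makes the finite set nonempty, so that it has a maximum
    have hlt : (insert a (A δ)).max' (Finset.insert_nonempty ..) < δ := by
      rw [Finset.max'_lt_iff]
      intro y hy
      rcases Finset.mem_insert.1 hy with rfl | hy
      · exact hab.trans_le hbδ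
      · exact hA δ hδS y hy
    exact disjoint_left.1 (hd _)
      ⟨hδS, fun β hβ => Finset.le_max' _ _ (Finset.mem_insert_of_mem hβ)⟩ (hδ _ hlt)
  have : Countable (Iic γ) := (countable_Iic_omega1 γ).to_subtype
  have hU : {α ∈ S | ∀ β ∈ A α, β ≤ γ} ⊆
      ⋃ B : Finset (Iic γ), {α ∈ S | A α = B.map (Function.Embedding.subtype _)} := by
    rintro α ⟨hαS, hα⟩
    refine mem_iUnion.2 ⟨(A α).subtype (· ∈ Iic γ), hαS, ?_⟩
    exact (Finset.subtype_map_of_mem (p := (· ∈ Iic γ)) hα).symm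
  obtain ⟨B, hB⟩ := (isStationary_iUnion_iff_of_countable cof_omega1_ne_aleph0).1 (hγ.mono hU)
  exact ⟨_, hB⟩

/-- The `Δ`-system lemma for stationary sets, in a form in which the pairwise intersections are only
required to be contained in the finite set `R`. If `m x` is the first index at which `x` occurs, then
by Fodor's lemma the set of the `m x < α` with `x ∈ s α` may be assumed not to depend on `α`. -/
theorem exists_stationary_deltaSystem {X : Type*} [DecidableEq X] {S : Set Omega1.{u}}
    (hS : IsStationary S) (s : Omega1.{u} → Finset X) :
    ∃ T ⊆ S, IsStationary T ∧ ∃ R : Finset X, ∀ α ∈ T, ∀ β ∈ T, α ≠ β → s α ∩ s β ⊆ R := by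
  have hm : ∀ x, ∃ m, (∃ α ∈ S, x ∈ s α) → (m ∈ S ∧ x ∈ s m ∧ ∀ α ∈ S, x ∈ s α → m ≤ α) := by
    intro x
    by_cases h : ∃ α ∈ S, x ∈ s α
    · obtain ⟨m, hm, hmin⟩ := WellFounded.has_min (wellFounded_lt (α := Omega1.{u}))
        {α ∈ S | x ∈ s α} h
      exact ⟨m, fun _ => ⟨hm.1, hm.2, fun α hα hx => not_lt.1 (hmin α ⟨hα, hx⟩)⟩⟩
    · exact ⟨Classical.arbitrary _, fun h' => absurd h' h⟩
  -- `m x` is the first place where `x` occurs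
  choose m hm using hm
  obtain ⟨B, hB⟩ := exists_stationary_const_finset hS
    (fun α => ((s α).image m).filter (· < α)) fun α _ β hβ => (Finset.mem_filter.1 hβ).2
  have key : ∀ α ∈ S, ∀ β, α < β → (((s β).image m).filter (· < β)) = B →
      s α ∩ s β ⊆ B.biUnion s := by
    intro α hα β hαβ hBβ x hx
    rw [Finset.mem_inter] at hx
    obtain ⟨-, h2, h3⟩ := hm x ⟨α, hα, hx.1⟩
    refine Finset.mem_biUnion.2 ⟨m x, ?_, h2⟩
    rw [← hBβ, Finset.mem_filter]
    exact ⟨Finset.mem_image_of_mem _ hx.2, (h3 α hα hx.1).trans_lt hαβ⟩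
  refine ⟨_, fun α hα => hα.1, hB, B.biUnion s, fun α hα β hβ hne => ?_⟩
  rcases lt_or_gt_of_ne hne with h | h
  · exact key α hα.1 β h hβ.2
  · rw [Finset.inter_comm]
    exact key β hβ.1 α h hα.2

/-! ### The forcing relation -/

section Names
variable {P : Type u} [Preorder P] {p q : P} {x y z x' y' a b : PName P}

theorem forces_eq_mk_iff {ι κ : Type u} {c : ι → Set P} {d : κ → Set P} {x : ι → PName P}
    {y : κ → PName P} : p ⊩ (PName.mk ι c x).eq (.mk κ d y) ↔
      (∀ i : ι, ∀ s ∈ c i, ∀ q ≤ p, q ≤ s →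
        ∃ r ≤ q, ∃ j : κ, (∃ s' ∈ d j, r ≤ s') ∧ r ⊩ (x i).eq (y j)) ∧
      (∀ j : κ, ∀ s ∈ d j, ∀ q ≤ p, q ≤ s →
        ∃ r ≤ q, ∃ i : ι, (∃ s' ∈ c i, r ≤ s') ∧ r ⊩ (x i).eq (y j)) := Iff.rfl

theorem forces_mem_mk_iff {κ : Type u} {d : κ → Set P} {y : κ → PName P} :
    p ⊩ x.mem (.mk κ d y) ↔
      ∀ q ≤ p, ∃ r ≤ q, ∃ j : κ, (∃ s ∈ d j, r ≤ s) ∧ r ⊩ x.eq (y j) := Iff.rfl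

theorem forces_eq_mono (h : p ⊩ x.eq y) (hq : q ≤ p) : q ⊩ x.eq y := by
  cases x; cases y
  rw [forces_eq_mk_iff] at h ⊢
  exact ⟨fun i s hs r hr => h.1 i s hs r (hr.trans hq),
    fun j s hs r hr => h.2 j s hs r (hr.trans hq)⟩

theorem forces_mem_mono (h : p ⊩ x.mem y) (hq : q ≤ p) : q ⊩ x.mem y := by
  cases y
  exact fun r hr => h r (hr.trans hq)

theorem forces_eq_of_dense (h : ∀ q ≤ p, ∃ r ≤ q, r ⊩ x.eq y) : p ⊩ x.eq y := by
  cases x; cases y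
  refine forces_eq_mk_iff.2 ⟨fun i s hs q hq hqs => ?_, fun j s hs q hq hqs => ?_⟩
  · obtain ⟨r, hr, hxy⟩ := h q hq
    obtain ⟨t, ht, h'⟩ := (forces_eq_mk_iff.1 hxy).1 i s hs r le_rfl (hr.trans hqs)
    exact ⟨t, ht.trans hr, h'⟩
  · obtain ⟨r, hr, hxy⟩ := h q hq
    obtain ⟨t, ht, h'⟩ := (forces_eq_mk_iff.1 hxy).2 j s hs r le_rfl (hr.trans hqs)
    exact ⟨t, ht.trans hr, h'⟩

theorem forces_eq_refl (p : P) (x : PName P) : p ⊩ x.eq x := by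
  induction x generalizing p with
  | mk ι c x ih =>
    exact forces_eq_mk_iff.2
      ⟨fun i s hs q _ hqs => ⟨q, le_rfl, i, ⟨s, hs, hqs⟩, ih i q⟩,
        fun i s hs q _ hqs => ⟨q, le_rfl, i, ⟨s, hs, hqs⟩, ih i q⟩⟩

theorem forces_eq_symm (h : p ⊩ x.eq y) : p ⊩ y.eq x := by
  induction x generalizing y p with
  | mk ι c x ih =>
    cases y
    rw [forces_eq_mk_iff] at h ⊢
    refine ⟨fun j s hs q hq hqs => ?_, fun i s hs q hq hqs => ?_⟩
    · obtain ⟨r, hr, i, hi, h'⟩ := h.2 j s hs q hq hqs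
      exact ⟨r, hr, i, hi, ih i h'⟩
    · obtain ⟨r, hr, j, hj, h'⟩ := h.1 i s hs q hq hqs
      exact ⟨r, hr, j, hj, ih i h'⟩

theorem forces_eq_trans (h₁ : p ⊩ x.eq y) (h₂ : p ⊩ y.eq z) : p ⊩ x.eq z := by
  induction x generalizing y z p with
  | mk ι c x ih =>
    cases y; cases z
    rw [forces_eq_mk_iff] at h₁ h₂ ⊢
    refine ⟨fun i s hs q hq hqs => ?_, fun k s hs q hq hqs => ?_⟩
    · obtain ⟨r, hr, j, ⟨s', hs', hrs'⟩, hxy⟩ := h₁.1 i s hs q hq hqs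
      obtain ⟨t, ht, k, hk, hyz⟩ := h₂.1 j s' hs' r (hr.trans hq) hrs'
      exact ⟨t, ht.trans hr, k, hk, ih i (forces_eq_mono hxy ht) hyz⟩
    · obtain ⟨r, hr, j, ⟨s', hs', hrs'⟩, hyz⟩ := h₂.2 k s hs q hq hqs
      obtain ⟨t, ht, i, hi, hxy⟩ := h₁.2 j s' hs' r (hr.trans hq) hrs'
      exact ⟨t, ht.trans hr, i, hi, ih i hxy (forces_eq_mono hyz ht)⟩

theorem forces_mem_congr (h : p ⊩ x.eq x') (hx : p ⊩ x.mem y) : p ⊩ x'.mem y := by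
  cases y
  intro q hq
  obtain ⟨r, hr, j, hj, hxy⟩ := hx q hq
  exact ⟨r, hr, j, hj,
    forces_eq_trans (forces_eq_symm (forces_eq_mono h (hr.trans hq))) hxy⟩

theorem forces_mem_mk {κ : Type u} {d : κ → Set P} {y : κ → PName P} (j : κ) {s : P}
    (hs : s ∈ d j) (hp : p ≤ s) : p ⊩ (y j).mem (.mk κ d y) :=
  fun q hq => ⟨q, le_rfl, j, ⟨s, hs, hq.trans hp⟩, forces_eq_refl q _⟩

/-! ### Pairs and check names -/

theorem forces_upair_congr (hx : p ⊩ x.eq x') (hy : p ⊩ y.eq y') :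
    p ⊩ (x.upair y).eq (x'.upair y') := by
  have h : ∀ i : ULift.{u} Bool, p ⊩ (bif i.down then x else y).eq (bif i.down then x' else y') := by
    rintro ⟨_ | _⟩
    exacts [hy, hx]
  exact forces_eq_mk_iff.2
    ⟨fun i s _ q hq _ => ⟨q, le_rfl, i, ⟨q, mem_univ _, le_rfl⟩, forces_eq_mono (h i) hq⟩,
      fun i s _ q hq _ => ⟨q, le_rfl, i, ⟨q, mem_univ _, le_rfl⟩, forces_eq_mono (h i) hq⟩⟩

theorem forces_opair_congr (hx : p ⊩ x.eq x') (hy : p ⊩ y.eq y') :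
    p ⊩ (x.opair y).eq (x'.opair y') :=
  forces_upair_congr (forces_upair_congr hx hx) (forces_upair_congr hx hy)

theorem exists_forces_of_upair_eq_left (h : p ⊩ (x.upair y).eq (a.upair b)) :
    ∃ r ≤ p, (r ⊩ x.eq a) ∨ (r ⊩ x.eq b) := by
  obtain ⟨r, hr, ⟨_ | _⟩, -, h'⟩ :=
    (forces_eq_mk_iff.1 h).1 ⟨true⟩ p (mem_univ _) p le_rfl le_rfl
  exacts [⟨r, hr, .inr h'⟩, ⟨r, hr, .inl h'⟩]

theorem exists_forces_of_upair_eq_right (h : p ⊩ (x.upair y).eq (a.upair b)) :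
    ∃ r ≤ p, (r ⊩ y.eq a) ∨ (r ⊩ y.eq b) := by
  obtain ⟨r, hr, ⟨_ | _⟩, -, h'⟩ :=
    (forces_eq_mk_iff.1 h).1 ⟨false⟩ p (mem_univ _) p le_rfl le_rfl
  exacts [⟨r, hr, .inr h'⟩, ⟨r, hr, .inl h'⟩]

theorem forces_fst_eq_of_opair_eq (h : p ⊩ (x.opair y).eq (a.opair b)) : p ⊩ x.eq a := by
  refine forces_eq_of_dense fun q hq => ?_
  obtain ⟨r, hr, h' | h'⟩ := exists_forces_of_upair_eq_left (forces_eq_mono h hq)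
  · obtain ⟨t, ht, h'' | h''⟩ := exists_forces_of_upair_eq_left h' <;>
      exact ⟨t, ht.trans hr, h''⟩
  · obtain ⟨t, ht, h'' | h''⟩ := exists_forces_of_upair_eq_left (forces_eq_symm h') <;>
      exact ⟨t, ht.trans hr, forces_eq_symm h''⟩

theorem exists_forces_of_opair_eq (h : p ⊩ (x.opair y).eq (a.opair b)) :
    ∃ r ≤ p, (r ⊩ y.eq a) ∨ (r ⊩ y.eq b) := by
  obtain ⟨r, hr, h' | h'⟩ := exists_forces_of_upair_eq_right h
  · obtain ⟨t, ht, h'' | h''⟩ := exists_forces_of_upair_eq_right h' <;>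
      exact ⟨t, ht.trans hr, .inl h''⟩
  · obtain ⟨t, ht, h''⟩ := exists_forces_of_upair_eq_right h'
    exact ⟨t, ht.trans hr, h''⟩

theorem forces_snd_eq_of_opair_eq (h : p ⊩ (x.opair y).eq (a.opair b)) : p ⊩ y.eq b := by
  have hxa := forces_fst_eq_of_opair_eq h
  refine forces_eq_of_dense fun q hq => ?_
  obtain ⟨r, hr, h₁ | h₁⟩ := exists_forces_of_opair_eq (forces_eq_mono h hq)
  · obtain ⟨t, ht, h₂ | h₂⟩ :=
      exists_forces_of_opair_eq (forces_eq_symm (forces_eq_mono h (hr.trans hq)))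
    · -- here `y = a = x = b`
      have htp := ht.trans (hr.trans hq)
      exact ⟨t, ht.trans hr, forces_eq_trans (forces_eq_mono h₁ ht)
        (forces_eq_symm (forces_eq_trans h₂ (forces_eq_mono hxa htp)))⟩
    · exact ⟨t, ht.trans hr, forces_eq_symm h₂⟩
  · exact ⟨r, hr, h₁⟩

theorem check_eq_mk (P : Type u) (α : Omega1.{u}) :
    check P α = .mk (Iio α) (fun _ => univ) (fun β => check P β.1) := by
  rw [check]

theorem eq_of_forces_check_eq {α β : Omega1.{u}} (h : p ⊩ (check P α).eq (check P β)) : α = β := by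
  induction α using WellFoundedLT.induction generalizing β p with
  | ind α ih =>
    rw [check_eq_mk P α, check_eq_mk P β, forces_eq_mk_iff] at h
    rcases lt_trichotomy α β with hlt | heq | hlt
    · obtain ⟨r, -, i, -, h'⟩ := h.2 ⟨α, hlt⟩ p (mem_univ _) p le_rfl le_rfl
      exact absurd (ih i.1 i.2 h') i.2.ne
    · exact heq
    · obtain ⟨r, -, j, -, h'⟩ := h.1 ⟨β, hlt⟩ p (mem_univ _) p le_rfl le_rfl
      exact absurd (ih β hlt h') (ne_of_gt j.2)

theorem forces_check_mem_checkSet {C : Set Omega1.{u}} {α : Omega1.{u}} (h : α ∈ C) (p : P) :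
    p ⊩ (check P α).mem (checkSet P C) :=
  forces_mem_mk (y := fun β : C => check P β.1) ⟨α, h⟩ (mem_univ p) le_rfl

theorem mem_of_forces_check_mem_checkSet {C : Set Omega1.{u}} {α : Omega1.{u}}
    (h : p ⊩ (check P α).mem (checkSet P C)) : α ∈ C := by
  obtain ⟨r, -, β, -, h'⟩ := h p le_rfl
  rw [eq_of_forces_check_eq h']
  exact β.2

/-! ### Clubs of the ground model and of the extension -/

theorem forces_isClub_mono {C : PName P} (h : p ⊩ isClub C) (hq : q ≤ p) : q ⊩ isClub C :=
  ⟨fun z r hr => h.1 z r (hr.trans hq), fun α r hr => h.2.1 α r (hr.trans hq),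
    fun δ r hr => h.2.2 δ r (hr.trans hq)⟩

theorem isSuccLimit_of_forall_exists_between {δ : Omega1.{u}}
    (h : ∀ α < δ, ∃ β, α < β ∧ β < δ) (h₀ : ∃ α, α < δ) : Order.IsSuccLimit δ := by
  obtain ⟨α, hα⟩ := h₀
  refine ⟨fun hm => hα.not_ge (hm hα.le), fun β hβ => ?_⟩
  obtain ⟨γ, h₁, h₂⟩ := h β hβ.lt
  exact hβ.2 h₁ h₂

/-- A club of the ground model remains a club in every generic extension. -/
theorem forces_isClub_checkSet {C : Set Omega1.{u}} (hC : IsClub C) (p : P) :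
    p ⊩ isClub (checkSet P C) := by
  refine ⟨fun z q _ hz r hr => ?_, fun α q _ => ?_, fun δ q _ h => ?_⟩
  · obtain ⟨t, ht, β, hβ, hz⟩ := hz r hr
    exact ⟨t, ht, ⟨β.1, mem_univ _⟩, hβ, hz⟩
  · obtain ⟨β, hβ⟩ := exists_gt α
    obtain ⟨γ, hγ, hβγ⟩ := hC.isCofinal β
    exact ⟨q, le_rfl, ⟨γ, hβ.trans_le hβγ⟩, forces_check_mem_checkSet hγ q⟩
  · have h' : ∀ α < δ.1, ∃ β ∈ C, α < β ∧ β < δ.1 := fun α hα => by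
      obtain ⟨r, -, β, hβ⟩ := h ⟨α, hα⟩ q le_rfl
      exact ⟨β.1, mem_of_forces_check_mem_checkSet hβ, β.2⟩
    obtain ⟨α, hα⟩ := not_isMin_iff.1 δ.2.1
    obtain ⟨β, hβ, -, hβδ⟩ := h' α hα
    refine forces_check_mem_checkSet (hC.isLUB_mem (t := C ∩ Iio δ.1) inter_subset_left
      ⟨β, hβ, hβδ⟩ ⟨fun x hx => hx.2.le, fun y hy => not_lt.1 fun hlt => ?_⟩) q
    obtain ⟨γ, hγ, h₁, h₂⟩ := h' y hlt
    exact h₁.not_ge (hy ⟨hγ, h₂⟩)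

end Names
/-! ### A common form of the two chain conditions -/

/-- Every sequence with index set in `stat E` has a subsequence with index set in `stat E` such that
any finitely many terms, as many as `ok` allows, have a common extension. With `ok` always true this
is `IsPC (stat E)`, and with `ok k ↔ k ≤ n` it is `IsKnaster (stat E) n`. The sequences are indexed
by all of `ω₁`; only the terms with index in `S` matter. -/
def IsStatLinked (ok : ℕ → Prop) (E : Set Omega1.{u}) (P : Type u) [Preorder P] : Prop :=
  ∀ S ∈ stat E, ∀ p : Omega1.{u} → P, ∃ T ∈ stat E, T ⊆ S ∧
    ∀ F : Finset Omega1.{u}, ok F.card → ↑F ⊆ T → ∃ r, ∀ α ∈ F, r ≤ p α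

/-- The statement that `(Q, le)` satisfies `IsStatLinked ok E`. -/
noncomputable def isStatLinked {P : Type u} [Preorder P] (ok : ℕ → Prop) (E : Set Omega1.{u})
    (Q le : PName P) : Sentence P :=
  all fun S : PName P => all fun f : PName P => ((isStat E S).and (isFun f S Q)).imp <|
    ex fun T : PName P => (isStat E T).and <| (subset T S).and <|
      all fun F : {F : Finset Omega1.{u} // ok F.card} =>
        (all fun α : {α : Omega1.{u} // α ∈ F.1} => (check P α.1).mem T).imp
          (hasLowerBound Q le f F.1)

section
variable {P : Type u} [Preorder P] {ok : ℕ → Prop} {E : Set Omega1.{u}}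

theorem IsStatLinked.exists_subsequence (h : IsStatLinked ok E P) {S : Set Omega1.{u}}
    (hS : S ∈ stat E) (p : S → P) : ∃ T ∈ stat E, T ⊆ S ∧
      ∀ F : Finset S, ok F.card → (∀ α ∈ F, (α : Omega1.{u}) ∈ T) → ∃ r, ∀ α ∈ F, r ≤ p α := by
  classical
  obtain ⟨α₀, hα₀⟩ := hS.2.nonempty
  obtain ⟨T, hT, hTS, h⟩ := h S hS fun α => if hα : α ∈ S then p ⟨α, hα⟩ else p ⟨α₀, hα₀⟩
  refine ⟨T, hT, hTS, fun F hF hFT => ?_⟩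
  obtain ⟨r, hr⟩ := h (F.map (Function.Embedding.subtype _)) (by simpa using hF) (by
    intro α hα
    obtain ⟨β, hβ, rfl⟩ := Finset.mem_map.1 hα
    exact hFT β hβ)
  refine ⟨r, fun α hα => ?_⟩
  simpa using hr α (Finset.mem_map_of_mem _ hα)

theorem IsStatLinked.isPC (h : IsStatLinked (fun _ => True) E P) : IsPC (stat E) P :=
  fun _ hS p => (h.exists_subsequence hS p).imp fun _ hT =>
    ⟨hT.1, hT.2.1, fun F => hT.2.2 F trivial⟩

theorem IsStatLinked.isKnaster {n : ℕ} (h : IsStatLinked (· ≤ n) E P) : IsKnaster (stat E) n P :=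
  fun _ hS p => h.exists_subsequence hS p

theorem isKnaster_of_le_one {n : ℕ} (hn : n ≤ 1) : IsKnaster (stat E) n P := by
  intro S hS p
  refine ⟨S, hS, subset_rfl, fun F hF _ => ?_⟩
  obtain ⟨α₀, hα₀⟩ := hS.2.nonempty
  rcases F.eq_empty_or_nonempty with rfl | ⟨α, hα⟩
  · exact ⟨p ⟨α₀, hα₀⟩, by simp⟩
  · exact ⟨p α, fun β hβ => by rw [Finset.card_le_one.1 (hF.trans hn) α hα β hβ]⟩

theorem forces_isStatLinked_of_isStatPC {p : P} {Q le : PName P} (h : p ⊩ isStatPC E Q le) :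
    p ⊩ isStatLinked (fun _ => True) E Q le := by
  intro S f q hq hSf r hr
  obtain ⟨t, ht, T, hT, hTS, hc⟩ := h S f q hq hSf r hr
  exact ⟨t, ht, T, hT, hTS, fun F => hc F.1⟩

/-- The countable chain condition, in the form in which it is used: a maximal antichain of a set
`B` of conditions is countable. -/
theorem IsStatLinked.exists_countable_predense (h : IsStatLinked ok E P) (hE : IsStationary E)
    (ok2 : ok 2) (B : Set P) :
    ∃ A ⊆ B, A.Countable ∧ ∀ b ∈ B, ∃ a ∈ A, ∃ r, r ≤ a ∧ r ≤ b := by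
  obtain ⟨A, hA⟩ := zorn_subset
    {A : Set P | A ⊆ B ∧ A.Pairwise fun a b => ¬ ∃ r, r ≤ a ∧ r ≤ b} fun c hc hchain =>
      ⟨⋃₀ c, ⟨sUnion_subset fun a ha => (hc ha).1,
        (pairwise_sUnion hchain.directedOn).2 fun a ha => (hc ha).2⟩,
        fun a ha => subset_sUnion_of_mem ha⟩
  refine ⟨A, hA.prop.1, ?_, fun b hb => ?_⟩
  · by_contra hcount
    have hle : #Omega1.{u} ≤ #A := by
      rw [mk_toType, Ordinal.card_omega, aleph_one_le_iff, ← not_le,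
        le_aleph0_iff_set_countable]
      exact hcount
    obtain ⟨f⟩ := hle
    obtain ⟨T, hT, -, hlink⟩ := h E ⟨subset_rfl, hE⟩ fun α => (f α : P)
    obtain ⟨α, hα, -⟩ := hT.2 .univ
    obtain ⟨γ, hγ⟩ := exists_gt α
    obtain ⟨β, hβ, hβγ⟩ := hT.2 (isClub_Ici γ)
    have hne : α ≠ β := (hγ.trans_le hβγ).ne
    obtain ⟨r, hr⟩ := hlink {α, β} (by rwa [Finset.card_pair hne]) (by simp [insert_subset_iff, *])
    exact hA.prop.2 (f α).2 (f β).2 (fun he => hne (f.injective (Subtype.ext he)))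
      ⟨r, hr α (by simp), hr β (by simp)⟩
  · by_contra! hb'
    have hbA : b ∉ A := fun hbA => hb' b hbA b le_rfl le_rfl
    have : insert b A ⊆ A := hA.le_of_ge
      ⟨insert_subset hb hA.prop.1, hA.prop.2.insert fun a ha _ =>
        ⟨fun ⟨r, h₁, h₂⟩ => hb' a ha r h₂ h₁, fun ⟨r, h₁, h₂⟩ => hb' a ha r h₁ h₂⟩⟩
      (subset_insert b A)
    exact hbA (this (mem_insert b A))

/-- Under the countable chain condition, a club of the extension contains a club of the ground
model, namely the set of the ordinals that `p` forces into it. -/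
theorem IsStatLinked.isClub_setOf_forces (h : IsStatLinked ok E P) (hE : IsStationary E)
    (ok2 : ok 2) {p : P} {C : PName P} (hC : p ⊩ isClub C) :
    IsClub {β | p ⊩ (check P β).mem C} := by
  have hlim : ∀ δ, (∃ α, α < δ) → (∀ α < δ, ∀ q ≤ p, ∃ r ≤ q, ∃ β, (α < β ∧ β < δ) ∧
      r ⊩ (check P β).mem C) → p ⊩ (check P δ).mem C := by
    intro δ h₀ hδ
    have hδ' : Order.IsSuccLimit δ := isSuccLimit_of_forall_exists_between (fun α hα => by
      obtain ⟨_, _, β, hβ, _⟩ := hδ α hα p le_rfl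
      exact ⟨β, hβ⟩) h₀
    refine hC.2.2 ⟨δ, hδ'⟩ p le_rfl fun α q hq => ?_
    obtain ⟨r, hr, β, hβ, h'⟩ := hδ α.1 α.2 q hq
    exact ⟨r, hr, ⟨β, hβ⟩, h'⟩
  constructor
  · rw [dirSupClosed_iff_of_linearOrder]
    intro d hd ⟨β, hβ⟩ δ hδ
    by_cases hmem : δ ∈ d
    · exact hd hmem
    have hlt : ∀ β ∈ d, β < δ := fun β hβ =>
      lt_of_le_of_ne (hδ.1 hβ) fun he => hmem (he ▸ hβ)
    refine hlim δ ⟨β, hlt β hβ⟩ fun α hα q hq => ?_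
    obtain ⟨β, hβ, hαβ⟩ := (lt_isLUB_iff hδ).1 hα
    exact ⟨q, le_rfl, β, ⟨hαβ, hlt β hβ⟩, forces_mem_mono (hd hβ) hq⟩
  · -- a countable predense set of conditions decides some element of `C` above `α`, and `g α`
    -- bounds the countably many ordinals so obtained; the closure points of `g` are then in `C`
    have hg : ∀ α, ∃ γ, ∀ q ≤ p, ∃ r ≤ q, ∃ β, (α < β ∧ β < γ) ∧ r ⊩ (check P β).mem C := by
      intro α
      obtain ⟨A, hA, hAc, hAd⟩ := h.exists_countable_predense hE ok2
        {q | ∃ β > α, q ⊩ (check P β).mem C}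
      have hA' : ∀ a ∈ A, ∃ β > α, a ⊩ (check P β).mem C := hA
      choose! b hb₁ hb₂ using hA'
      obtain ⟨γ, hγ⟩ := exists_forall_lt_of_countable (hAc.image b)
      refine ⟨γ, fun q hq => ?_⟩
      obtain ⟨r, hr, β, hβ⟩ := hC.2.1 α q hq
      obtain ⟨a, ha, t, hta, htr⟩ := hAd r ⟨β.1, β.2, hβ⟩
      exact ⟨t, htr.trans hr, b a, ⟨hb₁ a ha, hγ _ ⟨a, ha, rfl⟩⟩, forces_mem_mono (hb₂ a ha) hta⟩
    choose g hg using hg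
    intro α
    obtain ⟨δ, hδ, hgδ⟩ := exists_gt_forall_map_lt g α
    refine ⟨δ, hlim δ ⟨α, hδ⟩ fun x hx q hq => ?_, hδ.le⟩
    obtain ⟨r, hr, β, hβ, h'⟩ := hg x q hq
    exact ⟨r, hr, β, ⟨hβ.1, hβ.2.trans (hgδ x hx)⟩, h'⟩

/-! ### One step of the iteration -/

/-- The name of the set of those `α ∈ S` for which `r α` belongs to the generic filter. -/
noncomputable def genericIndexSet (S : Set Omega1.{u}) (r : Omega1.{u} → P) : PName P :=
  .mk S (fun α => {r α}) (fun α => check P α.1)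

/-- The name of the sequence of the `x α`, for those `α ∈ S` for which `r α` belongs to the generic
filter. -/
noncomputable def genericSequence (S : Set Omega1.{u}) (r : Omega1.{u} → P)
    (x : Omega1.{u} → PName P) : PName P :=
  .mk S (fun α => {r α}) (fun α => .opair (check P α.1) (x α.1))

variable {S : Set Omega1.{u}} {r : Omega1.{u} → P} {x : Omega1.{u} → PName P} {α : Omega1.{u}}
  {p : P}

theorem forces_check_mem_genericIndexSet (hα : α ∈ S) (hp : p ≤ r α) :
    p ⊩ (check P α).mem (genericIndexSet S r) :=
  forces_mem_mk (y := fun β : S => check P β.1) ⟨α, hα⟩ (mem_singleton _) hp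

theorem exists_le_of_forces_check_mem_genericIndexSet
    (h : p ⊩ (check P α).mem (genericIndexSet S r)) : α ∈ S ∧ ∃ q ≤ p, q ≤ r α := by
  obtain ⟨q, hq, β, ⟨_, rfl, hqβ⟩, hαβ⟩ := h p le_rfl
  rw [eq_of_forces_check_eq hαβ]
  exact ⟨β.2, q, hq, hqβ⟩

theorem forces_opair_mem_genericSequence (hα : α ∈ S) (hp : p ≤ r α) :
    p ⊩ (PName.opair (check P α) (x α)).mem (genericSequence S r x) :=
  forces_mem_mk (y := fun β : S => PName.opair (check P β.1) (x β.1)) ⟨α, hα⟩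
    (mem_singleton _) hp

theorem forces_eq_of_forces_opair_mem_genericSequence {y : PName P}
    (h : p ⊩ (PName.opair (check P α) y).mem (genericSequence S r x)) : p ⊩ y.eq (x α) := by
  refine forces_eq_of_dense fun q hq => ?_
  obtain ⟨t, ht, β, -, heq⟩ := h q hq
  rw [eq_of_forces_check_eq (forces_fst_eq_of_opair_eq heq)]
  exact ⟨t, ht, forces_snd_eq_of_opair_eq heq⟩

theorem forces_isFun_genericSequence {Q : PName P} (hx : ∀ α ∈ S, r α ⊩ (x α).mem Q) (p : P) :
    p ⊩ isFun (genericSequence S r x) (genericIndexSet S r) Q := by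
  refine ⟨fun z q _ hz q' hq' => ?_, fun α q _ hα q' hq' => ?_, fun α y z q _ hyz => ?_⟩
  · obtain ⟨t, ht, α, ⟨_, rfl, htα⟩, heq⟩ := hz q' hq'
    exact ⟨t, ht, α.1, fun t' ht' => ⟨t', le_rfl, x α.1,
      forces_check_mem_genericIndexSet α.2 (ht'.trans htα),
      forces_mem_mono (hx α.1 α.2) (ht'.trans htα), forces_eq_mono heq ht'⟩⟩
  · obtain ⟨hαS, t, ht, htα⟩ :=
      exists_le_of_forces_check_mem_genericIndexSet (forces_mem_mono hα hq')
    exact ⟨t, ht, x α, forces_opair_mem_genericSequence hαS htα⟩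
  · exact forces_eq_trans (forces_eq_of_forces_opair_mem_genericSequence hyz.1)
      (forces_eq_symm (forces_eq_of_forces_opair_mem_genericSequence hyz.2))

/-- Some condition forces that stationarily many of the `r α` belong to the generic filter. -/
theorem IsStatLinked.exists_forces_isStat (h : IsStatLinked ok E P) (hE : IsStationary E)
    (ok2 : ok 2) (hS : S ∈ stat E) (r : Omega1.{u} → P) :
    ∃ p : P, p ⊩ isStat E (genericIndexSet S r) := by
  by_contra! hno
  -- otherwise densely many conditions force some club to be disjoint from the set
  have hdense : ∀ p : P, ∃ q ≤ p, ∃ C : PName P, q ⊩ isClub C ∧ ∀ t ≤ q, ∀ α,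
      (t ⊩ (check P α).mem C) → ¬ t ⊩ (check P α).mem (genericIndexSet S r) := by
    intro p
    by_contra! hp
    refine hno p ⟨fun z q _ hz q' hq' => ?_, fun C q hq hC q' hq' => ?_⟩
    · obtain ⟨t, ht, α, ⟨_, _, htα⟩, hz⟩ := hz q' hq'
      exact ⟨t, ht, ⟨α.1, hS.1 α.2⟩, ⟨t, mem_univ _, le_rfl⟩, hz⟩
    · obtain ⟨t, ht, α, h₁, h₂⟩ := hp q' (hq'.trans hq) C (forces_isClub_mono hC hq')
      exact ⟨t, ht, α, h₁, h₂⟩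
  obtain ⟨A, hA, hAc, hAd⟩ := h.exists_countable_predense hE ok2
    {q | ∃ C : PName P, q ⊩ isClub C ∧ ∀ t ≤ q, ∀ α,
      (t ⊩ (check P α).mem C) → ¬ t ⊩ (check P α).mem (genericIndexSet S r)}
  choose C hC hdisj using fun a : A => hA a.2
  have : Countable A := hAc.to_subtype
  obtain ⟨β, hβS, hβ⟩ := hS.2 (IsClub.iInter_of_countable cof_omega1_ne_aleph0
    fun a : A => h.isClub_setOf_forces hE ok2 (hC a))
  obtain ⟨q, hq, hqB⟩ := hdense (r β)
  obtain ⟨a, ha, t, hta, htq⟩ := hAd q hqB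
  exact hdisj ⟨a, ha⟩ t hta β (forces_mem_mono (mem_iInter.1 hβ ⟨a, ha⟩) hta)
    (forces_check_mem_genericIndexSet hβS (htq.trans hq))

/-- The ordinals that some extension of `p` forces into a stationary set form a stationary set. -/
theorem isStationary_setOf_exists_forces {T : PName P} (h : p ⊩ isStat E T) :
    IsStationary {α | ∃ q ≤ p, q ⊩ (check P α).mem T} := by
  intro C hC
  obtain ⟨q, hq, α, hαC, hαT⟩ := h.2 _ p le_rfl (forces_isClub_checkSet hC p) p le_rfl
  exact ⟨α, ⟨q, hq, hαT⟩, mem_of_forces_check_mem_checkSet hαC⟩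

/-- The chain condition for two-step iterations: for a sequence of pairs `(r α, d α)` such that
`r α` forces `d α ∈ Q`, the pairs `(s, e)` provide the common extensions. -/
theorem IsStatLinked.two_step (h : IsStatLinked ok E P) (hE : IsStationary E) (ok2 : ok 2)
    {D : Type u} (Q : PosetName P D) (hQ : ∀ p : P, p ⊩ isStatLinked ok E Q.set Q.le)
    (hS : S ∈ stat E) (r : Omega1.{u} → P) (d : Omega1.{u} → D)
    (hd : ∀ α ∈ S, r α ⊩ (Q.val (d α)).mem Q.set) :
    ∃ T ∈ stat E, T ⊆ S ∧ ∀ F : Finset Omega1.{u}, ok F.card → ↑F ⊆ T →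
      ∃ (s : P) (e : D), (s ⊩ (Q.val e).mem Q.set) ∧
        ∀ α ∈ F, s ≤ r α ∧ s ⊩ (PName.opair (Q.val e) (Q.val (d α))).mem Q.le := by
  obtain ⟨p₀, hp₀⟩ := h.exists_forces_isStat hE ok2 hS r
  obtain ⟨p₁, -, T, hT, hTS, hlink⟩ := hQ p₀ (genericIndexSet S r)
    (genericSequence S r fun α => Q.val (d α)) p₀ le_rfl
    ⟨hp₀, forces_isFun_genericSequence hd p₀⟩ p₀ le_rfl
  have hT' : ∀ α, (∃ q ≤ p₁, q ⊩ (check P α).mem T) →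
      α ∈ S ∧ ∃ q ≤ p₁, q ≤ r α ∧ q ⊩ (check P α).mem T := by
    rintro α ⟨q, hq, hα⟩
    obtain ⟨hαS, t, ht, htα⟩ :=
      exists_le_of_forces_check_mem_genericIndexSet (hTS (check P α) q hq hα)
    exact ⟨hαS, t, ht.trans hq, htα, forces_mem_mono hα ht⟩
  have hex : ∀ α, ∃ q, (∃ q ≤ p₁, q ⊩ (check P α).mem T) →
      q ≤ p₁ ∧ q ≤ r α ∧ q ⊩ (check P α).mem T := fun α => by
    by_cases hα : ∃ q ≤ p₁, q ⊩ (check P α).mem T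
    · obtain ⟨q, hq⟩ := (hT' α hα).2
      exact ⟨q, fun _ => hq⟩
    · exact ⟨p₁, fun h' => absurd h' hα⟩
  choose r' hr' using hex
  obtain ⟨U, hU, hUT, hUr⟩ := h {α | ∃ q ≤ p₁, q ⊩ (check P α).mem T}
    ⟨fun α hα => hS.1 (hT' α hα).1, isStationary_setOf_exists_forces hT⟩ r'
  refine ⟨U, hU, fun α hα => (hT' α (hUT hα)).1, fun F hF hFU => ?_⟩
  have hr'F : ∀ α ∈ F, r' α ≤ p₁ ∧ r' α ≤ r α ∧ r' α ⊩ (check P α).mem T :=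
    fun α hα => hr' α (hUT (hFU hα))
  rcases F.eq_empty_or_nonempty with rfl | ⟨α₀, hα₀⟩
  · exact ⟨p₁, Q.one, (Q.forces_isPoset p₁).1, by simp⟩
  obtain ⟨s, hs⟩ := hUr F hF hFU
  obtain ⟨s₁, hs₁, y, hyQ, hy⟩ := hlink ⟨F, hF⟩ s ((hs α₀ hα₀).trans (hr'F α₀ hα₀).1)
    (fun α => forces_mem_mono (hr'F α.1 α.2).2.2 (hs α.1 α.2)) s le_rfl
  obtain ⟨s₂, hs₂, e, ⟨c, hc, hs₂c⟩, hye⟩ := hyQ s₁ le_rfl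
  refine ⟨s₂, e, forces_mem_mk e hc hs₂c, fun α hα => ?_⟩
  have hle : s₂ ≤ r α := hs₂.trans (hs₁.trans ((hs α hα).trans (hr'F α hα).2.1))
  refine ⟨hle, forces_mem_congr (forces_opair_congr hye (forces_eq_refl _ _)) ?_⟩
  exact hy ⟨α, hα⟩ _ s₂ hs₂
    (forces_opair_mem_genericSequence (x := fun α => Q.val (d α)) (hT' α (hUT (hFU hα))).1 hle)

end
/-! ### Finite support iterations -/

namespace FSIteration
variable {I : Type u} [LinearOrder I] [WellFoundedLT I] {𝕀 : FSIteration I} {a : WithTop I}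

/-- The restriction of a condition of `P_a` to `ξ < a`. -/
def res (p : 𝕀.P a) (ξ : {ξ : I // (ξ : WithTop I) < a}) : 𝕀.P ξ.1 :=
  ⟨restrict p.1 ξ, (((𝕀.mem_carrier_iff a p.1).1 p.2).2 ξ).1⟩

theorem finite_support (p : 𝕀.P a) : {ξ | p.1 ξ ≠ (𝕀.Q ξ.1).one}.Finite :=
  ((𝕀.mem_carrier_iff a p.1).1 p.2).1

theorem res_forces_mem (p : 𝕀.P a) (ξ : {ξ : I // (ξ : WithTop I) < a}) :
    res p ξ ⊩ ((𝕀.Q ξ.1).val (p.1 ξ)).mem (𝕀.Q ξ.1).set :=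
  (((𝕀.mem_carrier_iff a p.1).1 p.2).2 ξ).2

theorem res_forces_le {p q : 𝕀.P a} (h : p ≤ q) (ξ : {ξ : I // (ξ : WithTop I) < a}) :
    res p ξ ⊩ (PName.opair ((𝕀.Q ξ.1).val (p.1 ξ)) ((𝕀.Q ξ.1).val (q.1 ξ))).mem (𝕀.Q ξ.1).le :=
  ((𝕀.le_iff a p q).1 h ξ).2

/-- A function `g` is a common extension of the conditions `p i`, `i ∈ F`, as soon as every initial
segment of `g` that extends the restrictions of the `p i` forces the next value of `g` to be in the
next poset and below the next values of the `p i`. -/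
theorem exists_mem_carrier_forall_le {ι : Type*} (F : Set ι) (p : ι → 𝕀.P a)
    (g : ∀ ξ : {ξ : I // (ξ : WithTop I) < a}, 𝕀.dom ξ.1)
    (hfin : {ξ | g ξ ≠ (𝕀.Q ξ.1).one}.Finite)
    (step : ∀ (ξ : {ξ : I // (ξ : WithTop I) < a}) (q : 𝕀.P ξ.1), q.1 = restrict g ξ →
      (∀ i ∈ F, q ≤ res (p i) ξ) → (q ⊩ ((𝕀.Q ξ.1).val (g ξ)).mem (𝕀.Q ξ.1).set) ∧
      ∀ i ∈ F, q ⊩ (PName.opair ((𝕀.Q ξ.1).val (g ξ))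
        ((𝕀.Q ξ.1).val ((p i).1 ξ))).mem (𝕀.Q ξ.1).le) :
    ∃ q : 𝕀.P a, q.1 = g ∧ ∀ i ∈ F, q ≤ p i := by
  have key : ∀ (ξ : I) (hξ : (ξ : WithTop I) < a),
      ∃ q : 𝕀.P ξ, q.1 = restrict g ⟨ξ, hξ⟩ ∧ ∀ i ∈ F, q ≤ res (p i) ⟨ξ, hξ⟩ := by
    intro ξ
    induction ξ using WellFoundedLT.induction with
    | ind ξ ih =>
      intro hξ
      have hlt : ∀ η : {η : I // (η : WithTop I) < (ξ : WithTop I)}, η.1 < ξ :=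
        fun η => WithTop.coe_lt_coe.1 η.2
      have hmem : restrict g ⟨ξ, hξ⟩ ∈ 𝕀.carrier ξ := by
        refine (𝕀.mem_carrier_iff _ _).2 ⟨?_, fun η => ?_⟩
        · refine hfin.preimage (f := fun η : {η : I // (η : WithTop I) < (ξ : WithTop I)} =>
            (⟨η.1, η.2.trans hξ⟩ : {ξ : I // (ξ : WithTop I) < a})) fun η _ η' _ h => ?_
          exact Subtype.ext (congrArg (fun x => x.1) h)
        · obtain ⟨⟨_, hq⟩, rfl, hle⟩ := ih η.1 (hlt η) (η.2.trans hξ)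
          exact ⟨hq, (step ⟨η.1, η.2.trans hξ⟩ _ rfl hle).1⟩
      refine ⟨⟨_, hmem⟩, rfl, fun i hi => (𝕀.le_iff _ _ _).2 fun η => ?_⟩
      obtain ⟨⟨_, hq⟩, rfl, hle⟩ := ih η.1 (hlt η) (η.2.trans hξ)
      exact ⟨hq, (step ⟨η.1, η.2.trans hξ⟩ _ rfl hle).2 i hi⟩
  have hmem : g ∈ 𝕀.carrier a := by
    refine (𝕀.mem_carrier_iff _ _).2 ⟨hfin, fun ξ => ?_⟩
    obtain ⟨⟨_, hq⟩, rfl, hle⟩ := key ξ.1 ξ.2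
    exact ⟨hq, (step ξ _ rfl hle).1⟩
  refine ⟨⟨g, hmem⟩, rfl, fun i hi => (𝕀.le_iff _ _ _).2 fun ξ => ?_⟩
  obtain ⟨⟨_, hq⟩, rfl, hle⟩ := key ξ.1 ξ.2
  exact ⟨hq, (step ξ _ rfl hle).2 i hi⟩

/-- At a coordinate that belongs to the support of at most one of the conditions `p i`, a common
extension exists: the value of that condition there, or else the largest element. -/
theorem exists_forces_of_subsingleton_support {ι : Type*} (F : Set ι) (p : ι → 𝕀.P a)
    (ξ : {ξ : I // (ξ : WithTop I) < a})
    (h : ∀ i ∈ F, ∀ j ∈ F, i ≠ j → (p i).1 ξ = (𝕀.Q ξ.1).one ∨ (p j).1 ξ = (𝕀.Q ξ.1).one) :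
    ∃ d : 𝕀.dom ξ.1, (d ≠ (𝕀.Q ξ.1).one → ∃ i ∈ F, (p i).1 ξ ≠ (𝕀.Q ξ.1).one) ∧
      ∀ q : 𝕀.P ξ.1, (∀ i ∈ F, q ≤ res (p i) ξ) → (q ⊩ ((𝕀.Q ξ.1).val d).mem (𝕀.Q ξ.1).set) ∧
        ∀ i ∈ F, q ⊩ (PName.opair ((𝕀.Q ξ.1).val d)
          ((𝕀.Q ξ.1).val ((p i).1 ξ))).mem (𝕀.Q ξ.1).le := by
  by_cases hex : ∃ i ∈ F, (p i).1 ξ ≠ (𝕀.Q ξ.1).one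
  · obtain ⟨i, hi, hne⟩ := hex
    refine ⟨(p i).1 ξ, fun _ => ⟨i, hi, hne⟩, fun q hq => ?_⟩
    have hmem := forces_mem_mono (res_forces_mem (p i) ξ) (hq i hi)
    obtain ⟨-, hone, hrefl, -⟩ := (𝕀.Q ξ.1).forces_isPoset q
    refine ⟨hmem, fun j hj => ?_⟩
    by_cases hij : i = j
    · subst hij
      exact hrefl _ q le_rfl hmem
    · rw [(h i hi j hj hij).resolve_left hne]
      exact hone _ q le_rfl hmem
  · push Not at hex
    refine ⟨(𝕀.Q ξ.1).one, fun h => absurd rfl h, fun q _ => ?_⟩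
    obtain ⟨hmem, hone, -⟩ := (𝕀.Q ξ.1).forces_isPoset q
    refine ⟨hmem, fun j hj => ?_⟩
    rw [hex j hj]
    exact hone _ q le_rfl hmem

/-- Let the conditions `p i` have a common extension `s` up to `η`, let `s` force that `e` is a
common extension at `η`, and let their supports be disjoint above `η`. Then the conditions have a
common extension. -/
theorem exists_forall_le_of_disjoint_above {ι : Type*} (F : Finset ι) (p : ι → 𝕀.P a)
    (η : {ξ : I // (ξ : WithTop I) < a})
    (h : ∀ ξ, η < ξ → ∀ i ∈ F, ∀ j ∈ F, i ≠ j →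
      (p i).1 ξ = (𝕀.Q ξ.1).one ∨ (p j).1 ξ = (𝕀.Q ξ.1).one)
    (s : 𝕀.P η.1) (hs : ∀ i ∈ F, s ≤ res (p i) η) (e : 𝕀.dom η.1)
    (he : s ⊩ ((𝕀.Q η.1).val e).mem (𝕀.Q η.1).set)
    (hle : ∀ i ∈ F, s ⊩ (PName.opair ((𝕀.Q η.1).val e)
      ((𝕀.Q η.1).val ((p i).1 η))).mem (𝕀.Q η.1).le) :
    ∃ q : 𝕀.P a, ∀ i ∈ F, q ≤ p i := by
  classical
  choose d hd hdq using fun ξ (hξ : η < ξ) =>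
    exists_forces_of_subsingleton_support (F : Set ι) p ξ (h ξ hξ)
  let g : ∀ ξ : {ξ : I // (ξ : WithTop I) < a}, 𝕀.dom ξ.1 := Function.update (fun ξ =>
    if hξ : ξ < η then s.1 ⟨ξ.1, WithTop.coe_lt_coe.2 hξ⟩
    else if hξ : η < ξ then d ξ hξ else (𝕀.Q ξ.1).one) η e
  have hg_lt : ∀ ξ (hξ : ξ < η), g ξ = s.1 ⟨ξ.1, WithTop.coe_lt_coe.2 hξ⟩ := fun ξ hξ => by
    simp only [g, Function.update_of_ne hξ.ne, dif_pos hξ]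
  have hg_eq : g η = e := Function.update_self ..
  have hg_gt : ∀ ξ (hξ : η < ξ), g ξ = d ξ hξ := fun ξ hξ => by
    simp only [g, Function.update_of_ne hξ.ne', dif_neg hξ.not_gt, dif_pos hξ]
  have hfin : {ξ | g ξ ≠ (𝕀.Q ξ.1).one}.Finite := by
    refine (((finite_support s).image fun ζ => (⟨ζ.1, ζ.2.trans η.2⟩ :
      {ξ : I // (ξ : WithTop I) < a})).union ((finite_singleton η).union
        (F.finite_toSet.biUnion fun i _ => finite_support (p i)))).subset fun ξ hξ => ?_
    rcases lt_trichotomy ξ η with hlt | rfl | hlt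
    · rw [mem_ofPred_eq, hg_lt ξ hlt] at hξ
      exact .inl ⟨_, hξ, rfl⟩
    · exact .inr (.inl rfl)
    · rw [mem_ofPred_eq, hg_gt ξ hlt] at hξ
      obtain ⟨i, hi, hne⟩ := hd ξ hlt hξ
      exact .inr (.inr (mem_biUnion hi hne))
  obtain ⟨q, -, hq⟩ := exists_mem_carrier_forall_le (F : Set ι) p g hfin fun ξ q hqg hq => by
    rcases lt_trichotomy ξ η with hlt | rfl | hlt
    · let ζ : {ζ : I // (ζ : WithTop I) < (η.1 : WithTop I)} :=
        ⟨ξ.1, WithTop.coe_lt_coe.2 hlt⟩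
      have hqs : q = res s ζ := Subtype.ext <| hqg.trans <| funext fun θ =>
        hg_lt ⟨θ.1, θ.2.trans ξ.2⟩
          (lt_trans (b := ξ) (show θ.1 < ξ.1 from WithTop.coe_lt_coe.1 θ.2) hlt)
      rw [hg_lt ξ hlt, hqs]
      exact ⟨res_forces_mem s ζ, fun i hi => res_forces_le (hs i hi) ζ⟩
    · have hqs : q = s := Subtype.ext <| hqg.trans <| funext fun θ =>
        hg_lt ⟨θ.1, θ.2.trans ξ.2⟩ (show θ.1 < ξ.1 from WithTop.coe_lt_coe.1 θ.2)
      rw [hg_eq, hqs]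
      exact ⟨he, hle⟩
    · rw [hg_gt ξ hlt]
      exact hdq ξ hlt q hq
  exact ⟨q, hq⟩

/-- Conditions with disjoint supports have a common extension. -/
theorem exists_forall_le_of_disjoint {ι : Type*} (F : Finset ι) (p : ι → 𝕀.P a)
    (h : ∀ ξ, ∀ i ∈ F, ∀ j ∈ F, i ≠ j →
      (p i).1 ξ = (𝕀.Q ξ.1).one ∨ (p j).1 ξ = (𝕀.Q ξ.1).one) :
    ∃ q : 𝕀.P a, ∀ i ∈ F, q ≤ p i := by
  choose g hg hgq using fun ξ =>
    exists_forces_of_subsingleton_support (F : Set ι) p ξ (h ξ)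
  obtain ⟨q, -, hq⟩ := exists_mem_carrier_forall_le (F : Set ι) p g
    ((F.finite_toSet.biUnion fun i _ => finite_support (p i)).subset fun ξ hξ => by
      obtain ⟨i, hi, hne⟩ := hg ξ hξ
      exact mem_biUnion hi hne) fun ξ q _ hq => hgq ξ q hq
  exact ⟨q, hq⟩

/-- Finite support iterations preserve the chain condition. The induction goes directly from the
largest element `η` of the root of a `Δ`-system of supports to `a`, so that successor and limit
stages need no separate treatment. -/
theorem isStatLinked {ok : ℕ → Prop} {E : Set Omega1.{u}} (hE : IsStationary E) (ok2 : ok 2)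
    (hQ : ∀ (ξ : I) (p : 𝕀.P ξ), p ⊩ StatIter.isStatLinked ok E (𝕀.Q ξ).set (𝕀.Q ξ).le)
    (a : WithTop I) : IsStatLinked ok E (𝕀.P a) := by
  classical
  induction a using WellFoundedLT.induction with
  | ind a ih =>
    intro S hS p
    obtain ⟨T, hTS, hT, R, hR⟩ :=
      exists_stationary_deltaSystem hS.2 fun α => (finite_support (p α)).toFinset
    have hdisj : ∀ ξ ∉ R, ∀ α ∈ T, ∀ β ∈ T, α ≠ β →
        (p α).1 ξ = (𝕀.Q ξ.1).one ∨ (p β).1 ξ = (𝕀.Q ξ.1).one := by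
      intro ξ hξ α hα β hβ hne
      by_contra! hor
      exact hξ (hR α hα β hβ hne (by simpa using hor))
    have hTE : T ∈ stat E := ⟨hTS.trans hS.1, hT⟩
    rcases R.eq_empty_or_nonempty with rfl | hne
    · refine ⟨T, hTE, hTS, fun F _ hF => exists_forall_le_of_disjoint F p ?_⟩
      exact fun ξ α hα β hβ => hdisj ξ (Finset.notMem_empty ξ) α (hF hα) β (hF hβ)
    · let η := R.max' hne
      obtain ⟨U, hU, hUT, hUF⟩ := (ih η.1 η.2).two_step hE ok2 (𝕀.Q η.1) (hQ η.1) hTE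
        (fun α => res (p α) η) (fun α => (p α).1 η) fun α _ => res_forces_mem (p α) η
      refine ⟨U, hU, hUT.trans hTS, fun F hF hFU => ?_⟩
      obtain ⟨s, e, he, hse⟩ := hUF F hF hFU
      refine exists_forall_le_of_disjoint_above F p η (fun ξ hξ α hα β hβ => ?_) s
        (fun α hα => (hse α hα).1) e he fun α hα => (hse α hα).2
      exact hdisj ξ (fun hξR => (R.le_max' ξ hξR).not_gt hξ) α (hUT (hFU hα)) β (hUT (hFU hβ))

end FSIteration
end StatIter

theorem mainTheorem7 (E : Set StatIter.Omega1.{u}) (hE : IsStationary E) :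
    (∀ (I : Type u) [LinearOrder I] [WellFoundedLT I] (𝕀 : StatIter.FSIteration I),
      𝕀.OfStatPC E → StatIter.IsPC (StatIter.stat E) 𝕀.limit) ∧
    (∀ (n : ℕ) (I : Type u) [LinearOrder I] [WellFoundedLT I] (𝕀 : StatIter.FSIteration I),
      𝕀.OfStatKnaster E n → StatIter.IsKnaster (StatIter.stat E) n 𝕀.limit) := by
  refine ⟨fun I _ _ 𝕀 h => ?_, fun n I _ _ 𝕀 h => ?_⟩
  · exact (StatIter.FSIteration.isStatLinked hE trivial
      (fun ξ p => StatIter.forces_isStatLinked_of_isStatPC (h ξ p)) ⊤).isPC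
  · rcases le_or_gt n 1 with hn | hn
    · exact StatIter.isKnaster_of_le_one hn
    · exact (StatIter.FSIteration.isStatLinked hE (ok := (· ≤ n)) hn h ⊤).isKnaster
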